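/- Let $\mathcal H$ be a complex Hilbert space and let $\mathcal K=\mathcal K(\mathcal H)$ be the $C^*$-algebra of all compact operators on $\mathcal H$. Let $E$ be a Hilbert $\mathcal K$-module, that is, a left $\mathcal K$-module with a $\mathcal K$-valued inner product $\langle\cdot,\cdot\rangle$ that is $\mathcal K$-linear in the first variable, satisfies $\langle x,y\rangle=\langle y,x\rangle^*$ and $\langle x,x\rangle\ge 0$ with equality only for $x=0$, and for which $E$ is complete in the norm $\|x\|=\|\langle x,x\rangle\|^{1/2}$. Let $B(E)$ be the algebra of adjointable operators on $E$ and let $K(E)\subseteq B(E)$ be the norm closure of the linear span of the operators $\Theta_{x,y}\colon z\mapsto\langle z,x\rangle y$, $x,y\in E$. For a densely defined $\mathcal K$-linear operator $t\colon \mathrm{Dom}(t)\subseteq E\to E$ the adjoint $t^*$ has domain $\{y\in E:\exists\,y'\in E\ \langle tx,y\rangle=\langle x,y'\rangle\ \text{for all } x\in \mathrm{Dom}(t)\}$, with $t^*y=y'$. The operator $t$ is called regular if it is closed and $\mathcal K$-linear, its domain is a dense submodule, $t^*$ is densely defined and $1+t^*t$ has dense range. Products such as $t^*t$ have their natural domain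 $\mathrm{Dom}(st)=\{x\in\mathrm{Dom}(t): tx\in\mathrm{Dom}(s)\}$. A regular operator $t$ is called Fredholm if there are $G,G'\in B(E)$ such that $Gt$ and $tG'$ are closable, their closures belong to $B(E)$, and $\overline{Gt}-1\in K(E)$, $\overline{tG'}-1\in K(E)$. For a closed submodule $X$ of $E$, an orthonormal basis of $X$ is a set $B\subseteq X$ such that $\langle x,x\rangle$ is a minimal projection of $\mathcal K$ for every $x\in B$ (a projection $e\ne0$ with $e\mathcal K e=\mathbb C e$), $\langle x,y\rangle=0$ for distinct $x,y\in B$, and $B$ generates a dense submodule of $X$. The dimension $\dim_{\mathcal K}X$ is the cardinality of an orthonormal basis of $X$; thus it is finite if and only if $X$ has a finite orthonormal basis. **Theorem.** Let $t$ be a regular operator on $E$. Then $t$ is Fredholm if and only if $\mathrm{Ran}\,t$ is a closed submodule of $E$ and both $\dim_{\mathcal K}\mathrm{Ker}\,t$ and $\dim_{\mathcal K}\mathrm{Ker}\,t^*$ are finite. -/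

import Mathlib

open scoped InnerProductSpace

noncomputable section

/-! ### The C⋆-algebra of compact operators on a Hilbert space -/

section CompactOperators

variable {H : Type*} [NormedAddCommGroup H] [InnerProductSpace ℂ H] [CompleteSpace H]

theorem isCompactOperator_of_star_mul_self (S : H →L[ℂ] H)
    (h : IsCompactOperator (star S * S : H →L[ℂ] H)) : IsCompactOperator S := by
  rw [show (⇑S : H → H) = ⇑(S : H →ₗ[ℂ] H) from rfl,
    isCompactOperator_iff_isCompact_closure_image_closedBall (S : H →ₗ[ℂ] H) one_pos]
  have hK := (IsCompactOperator.isCompact_closure_image_closedBall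
    (f := ((star S * S : H →L[ℂ] H) : H →ₗ[ℂ] H)) h 1).totallyBounded.subset subset_closure
  refine TotallyBounded.isCompact_of_isClosed (TotallyBounded.closure ?_) isClosed_closure
  rw [Metric.totallyBounded_iff]
  intro ε hε
  obtain ⟨t, hts, htf, hcov⟩ := Metric.finite_approx_of_totallyBounded hK (ε ^ 2 / 2) (by positivity)
  have hts' : ∀ a ∈ t, ∃ v ∈ Metric.closedBall (0 : H) 1,
      ((star S * S : H →L[ℂ] H) : H →ₗ[ℂ] H) v = a := fun a ha => hts ha
  choose! g hg using hts'
  refine ⟨(fun y => S (g y)) '' t, htf.image _, ?_⟩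
  rintro _ ⟨x, hx, rfl⟩
  obtain ⟨y, hy, hxy⟩ := Set.mem_iUnion₂.1 (hcov ⟨x, hx, rfl⟩)
  refine Set.mem_iUnion₂.2 ⟨S (g y), ⟨y, hy, rfl⟩, ?_⟩
  obtain ⟨hgy, hgy'⟩ := hg y hy
  rw [← hgy'] at hxy
  simp only [Metric.mem_ball, dist_eq_norm, Metric.mem_closedBall, sub_zero] at hxy hx hgy ⊢
  have h1 : ‖S (x - g y)‖ ^ 2 ≤ ‖(star S * S : H →L[ℂ] H) (x - g y)‖ * ‖x - g y‖ := by
    have := ContinuousLinearMap.apply_norm_sq_eq_inner_adjoint_left S (x - g y)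
    rw [this]
    exact (RCLike.re_le_norm _).trans (norm_inner_le_norm _ _)
  have h2 : ‖x - g y‖ ≤ 2 := (norm_sub_le _ _).trans (by linarith)
  have h3 : ‖(star S * S : H →L[ℂ] H) (x - g y)‖ < ε ^ 2 / 2 := by
    rw [map_sub]; exact hxy
  have h4 : ‖S (x - g y)‖ ^ 2 < ε ^ 2 := by
    nlinarith [norm_nonneg ((star S * S : H →L[ℂ] H) (x - g y)), norm_nonneg (x - g y)]
  have := lt_of_pow_lt_pow_left₀ 2 hε.le h4
  rwa [map_sub] at this

variable (H) in
/-- The C⋆-algebra of all compact operators on the Hilbert space `H`, with the norm, the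
involution and the order (`a ≤ b` iff `b - a` is a positive operator) inherited from the
bounded operators. -/
def compactOperators : NonUnitalStarSubalgebra ℂ (H →L[ℂ] H) where
  carrier := {T | IsCompactOperator T}
  add_mem' ha hb := IsCompactOperator.add ha hb
  zero_mem' := isCompactOperator_zero
  mul_mem' {a b} ha _ := IsCompactOperator.comp_clm ha b
  smul_mem' c _ ha := IsCompactOperator.smul ha c
  star_mem' {a} ha := by
    refine isCompactOperator_of_star_mul_self _ ?_
    rw [star_star]
    exact IsCompactOperator.comp_clm ha (star a)

instance isClosed_compactOperators :
    IsClosed ((compactOperators H : NonUnitalStarSubalgebra ℂ (H →L[ℂ] H)) :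
      Set (H →L[ℂ] H)) :=
  isClosed_setOfPred_isCompactOperator

instance starOrderedRing_compactOperators : StarOrderedRing (compactOperators H) := by
  refine StarOrderedRing.of_nonneg_iff' (fun {x y} hxy z => ?_) (fun x => ⟨fun hx => ?_, ?_⟩)
  · have hxy' : (x : H →L[ℂ] H) ≤ y := hxy
    change ((z : H →L[ℂ] H) + x) ≤ z + y
    gcongr
  · have hx' : (0 : H →L[ℂ] H) ≤ x := hx
    obtain ⟨s, hs⟩ := CStarAlgebra.nonneg_iff_eq_star_mul_self.1 hx'
    refine ⟨⟨s, isCompactOperator_of_star_mul_self s ?_⟩, Subtype.ext hs⟩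
    rw [← hs]
    exact x.2
  · rintro ⟨s, rfl⟩
    change (0 : H →L[ℂ] H) ≤ star (s : H →L[ℂ] H) * s
    exact star_mul_self_nonneg _

end CompactOperators

namespace HilbertModule

/-! ### Compositions, ranges and kernels of partially defined operators -/

section PartialMaps

variable {E : Type*} [AddCommGroup E] [Module ℂ E]

/-- The composition `s t` with domain `{x ∈ Dom t | t x ∈ Dom s}`. -/
def pcomp (s t : E →ₗ.[ℂ] E) : E →ₗ.[ℂ] E :=
  s.comp (t.domRestrict ((s.domain.comap t.toFun).map t.domain.subtype)) (by
    rintro ⟨x, ⟨y, hy, rfl⟩, hx⟩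
    exact hy)

/-- The everywhere defined operator `T`, as a partially defined operator. -/
def everywhere (T : E →ₗ[ℂ] E) : E →ₗ.[ℂ] E := T.toPMap ⊤

def ran (t : E →ₗ.[ℂ] E) : Submodule ℂ E := LinearMap.range t.toFun

/-- `Ker t = {x ∈ Dom t | t x = 0}`. -/
def kernel (t : E →ₗ.[ℂ] E) : Submodule ℂ E := (LinearMap.ker t.toFun).map t.domain.subtype

end PartialMaps

/-! ### Operators on a Hilbert module

`CStarModule A E` is a left Hilbert `A`-module whose inner product `⟪x, y⟫_A` is `A`-linear in
the second variable.  The inner product `⟨x, y⟩` that is `A`-linear in the first variable is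
`⟪y, x⟫_A`. -/

section General

variable (A : Type*) {E : Type*} [NonUnitalCStarAlgebra A] [PartialOrder A]
  [NormedAddCommGroup E] [NormedSpace ℂ E] [SMul A E] [CStarModule A E]

variable {A} in
theorem ext_inner {u v : E} (h : ∀ w : E, ⟪w, u⟫_A = ⟪w, v⟫_A) : u = v := by
  rw [← sub_eq_zero, ← CStarModule.inner_self (A := A), CStarModule.inner_sub_right, h, sub_self]

theorem norm_smul_le' (a : A) (y : E) : ‖a • y‖ ≤ ‖a‖ * ‖y‖ := by
  have h : ‖a • y‖ ^ 2 ≤ (‖a‖ * ‖y‖) ^ 2 := by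
    rw [CStarModule.norm_sq_eq A, mul_pow, CStarModule.norm_sq_eq A (x := y)]
    simp only [CStarModule.inner_op_smul_right, CStarModule.inner_op_smul_left]
    calc ‖a * (⟪y, y⟫_A * star a)‖ ≤ ‖a‖ * (‖⟪y, y⟫_A‖ * ‖star a‖) :=
          (norm_mul_le _ _).trans (by gcongr; exact norm_mul_le _ _)
      _ = ‖a‖ ^ 2 * ‖⟪y, y⟫_A‖ := by rw [norm_star]; ring
  exact le_of_sq_le_sq h (by positivity)

variable [StarOrderedRing A]

/-- `Θ_{x,y} z = ⟨z, x⟩ y`. -/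
def theta (x y : E) : E →L[ℂ] E :=
  LinearMap.mkContinuous
    { toFun := fun z => ⟪x, z⟫_A • y
      map_add' := fun z w => ext_inner (A := A) fun v => by simp [add_mul]
      map_smul' := fun c z => ext_inner (A := A) fun v => by simp [smul_mul_assoc] }
    (‖x‖ * ‖y‖) (fun z => by
      refine (norm_smul_le' A _ _).trans ?_
      calc ‖⟪x, z⟫_A‖ * ‖y‖ ≤ (‖x‖ * ‖z‖) * ‖y‖ := by
            gcongr; exact CStarModule.norm_inner_le E
        _ = ‖x‖ * ‖y‖ * ‖z‖ := by ring)

variable (E) in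
/-- `K(E)`: the norm closure of the linear span of the operators `Θ_{x,y}`. -/
def moduleCompacts : Submodule ℂ (E →L[ℂ] E) :=
  (Submodule.span ℂ {T | ∃ x y : E, T = theta A x y}).topologicalClosure

/-- `T ∈ B(E)`: there is `S : E → E` with `⟨T x, y⟩ = ⟨x, S y⟩` for all `x, y`. -/
def IsAdjointable (T : E →L[ℂ] E) : Prop :=
  ∃ S : E → E, ∀ x y : E, ⟪y, T x⟫_A = ⟪S y, x⟫_A

/-- `Dom t` is a submodule of `E` and `t` is `A`-linear. -/
def IsModuleLinear (t : E →ₗ.[ℂ] E) : Prop :=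
  ∀ (a : A) (x : t.domain), ∃ h : a • (x : E) ∈ t.domain, t ⟨a • (x : E), h⟩ = a • t x

/-- All pairs `(y, y')` with `⟨t x, y⟩ = ⟨x, y'⟩` for all `x ∈ Dom t`. -/
def adjointGraph (t : E →ₗ.[ℂ] E) : Submodule ℂ (E × E) where
  carrier := {p | ∀ x : t.domain, ⟪p.1, t x⟫_A = ⟪p.2, (x : E)⟫_A}
  add_mem' {p q} hp hq x := by simp [hp x, hq x]
  zero_mem' x := by simp
  smul_mem' c p hp x := by simp [hp x]

/-- The adjoint `t⋆`: its domain consists of all `y` for which there is `y'` with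
`⟨t x, y⟩ = ⟨x, y'⟩` for all `x ∈ Dom t`, and `t⋆ y = y'`. This `y'` is unique when `Dom t` is
dense, see `adjointGraph_functional`. -/
def adjoint (t : E →ₗ.[ℂ] E) : E →ₗ.[ℂ] E := (adjointGraph A t).toLinearPMap

theorem adjointGraph_functional (t : E →ₗ.[ℂ] E) (ht : Dense (t.domain : Set E)) :
    ∀ p ∈ adjointGraph A t, p.1 = 0 → p.2 = 0 := by
  rintro ⟨y, y'⟩ hp (rfl : y = 0)
  have hc : Continuous fun x : E => ⟪y', x⟫_A :=
    CStarModule.continuous_inner.comp (Continuous.prodMk_right y')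
  have h0 : (fun x : E => ⟪y', x⟫_A) = fun _ => 0 :=
    Continuous.ext_on ht hc continuous_const fun x hx => by
      have := hp ⟨x, hx⟩
      simpa using this.symm
  exact CStarModule.inner_self.1 (congrFun h0 y')

theorem graph_adjoint (t : E →ₗ.[ℂ] E) (ht : Dense (t.domain : Set E)) :
    (adjoint A t).graph = adjointGraph A t :=
  Submodule.toLinearPMap_graph_eq _ fun p hp => adjointGraph_functional A t ht p hp

/-- Regular operators on `E`. -/
structure IsRegular (t : E →ₗ.[ℂ] E) : Prop where
  moduleLinear : IsModuleLinear A t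
  closed : t.IsClosed
  dense_domain : Dense (t.domain : Set E)
  dense_adjoint_domain : Dense ((adjoint A t).domain : Set E)
  dense_range_one_add :
    Dense (ran (everywhere LinearMap.id + pcomp (adjoint A t) t) : Set E)

/-- `s` is closable, its closure is an element of `B(E)`, and the closure is `1` modulo `K(E)`. -/
def ClosureIsOneModCompacts (s : E →ₗ.[ℂ] E) : Prop :=
  s.IsClosable ∧ ∃ T : E →L[ℂ] E, IsAdjointable A T ∧
    s.closure = everywhere (T : E →ₗ[ℂ] E) ∧ T - 1 ∈ moduleCompacts A E

/-- `G` is a pseudo left inverse of `t`. -/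
def IsPseudoLeftInverse (G : E →L[ℂ] E) (t : E →ₗ.[ℂ] E) : Prop :=
  IsAdjointable A G ∧ ClosureIsOneModCompacts A (pcomp (everywhere (G : E →ₗ[ℂ] E)) t)

/-- `G` is a pseudo right inverse of `t`. -/
def IsPseudoRightInverse (G : E →L[ℂ] E) (t : E →ₗ.[ℂ] E) : Prop :=
  IsAdjointable A G ∧ ClosureIsOneModCompacts A (pcomp t (everywhere (G : E →ₗ[ℂ] E)))

/-- A (regular) operator is Fredholm if it has a pseudo left and a pseudo right inverse. -/
def IsFredholm (t : E →ₗ.[ℂ] E) : Prop :=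
  (∃ G : E →L[ℂ] E, IsPseudoLeftInverse A G t) ∧ ∃ G : E →L[ℂ] E, IsPseudoRightInverse A G t

/-! ### Orthonormal bases and the orthonormal dimension -/

variable {A} in
/-- A minimal projection: a nonzero projection `e` with `e A e = ℂ e`. -/
def IsMinimalProjection (e : A) : Prop :=
  IsStarProjection e ∧ e ≠ 0 ∧ ∀ a : A, ∃ c : ℂ, e * a * e = c • e

/-- Every element is a basic vector, and different elements are orthogonal. -/
def IsOrthonormalSystem (B : Set E) : Prop :=
  (∀ x ∈ B, IsMinimalProjection ⟪x, x⟫_A) ∧ ∀ x ∈ B, ∀ y ∈ B, x ≠ y → ⟪y, x⟫_A = 0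

/-- The `A`-submodule generated by `B`. -/
def generatedSubmodule (B : Set E) : Submodule ℂ E :=
  Submodule.span ℂ (B ∪ {z | ∃ (a : A), ∃ x ∈ B, z = a • x})

/-- `B` is an orthonormal basis of the submodule `X` of `E`: an orthonormal system in `X` that
generates a dense submodule of `X`. -/
def IsOrthonormalBasis (B : Set E) (X : Submodule ℂ E) : Prop :=
  B ⊆ X ∧ IsOrthonormalSystem A B ∧ (X : Set E) ⊆ closure (generatedSubmodule A B : Set E)

/-- `dim X = κ`: the submodule `X` has an orthonormal basis of cardinality `κ`. -/
def HasOrthonormalDim (X : Submodule ℂ E) (κ : Cardinal) : Prop :=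
  ∃ B : Set E, IsOrthonormalBasis A B X ∧ Cardinal.mk B = κ

/-- `dim X` is finite. -/
def FiniteOrthonormalDim (X : Submodule ℂ E) : Prop :=
  ∃ n : ℕ, HasOrthonormalDim A X n

end General

end HilbertModule

end

open scoped InnerProductSpace

noncomputable section

/-! Fix a unit vector ξ of H and the minimal projection e = |ξ⟩⟨ξ|. The corner eE is a Hilbert
space, since ⟪x, y⟫ = e⟪x, y⟫e is a scalar multiple of e there, and x ∈ E is controlled by its
slices |ξ⟩⟨η|x ∈ eE (`mem_of_forall_ketBra_smul_mem`, `norm_le_of_forall_norm_ketBra_smul_le`).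
Bounded module maps preserve eE, and elements of K(E) compress to compact operators on it
(`isCompactOperator_compression`). The theorem thus reduces to Atkinson's theorem on eE.

If Gt = 1 + k on Dom t with k ∈ K(E), then k = -1 on Ker t, so e Ker t is finite-dimensional; a
compactness argument bounds t from below on the part of eE complementary to the kernel, and slices
extend the bound to E, so Ran t is closed. If the closure of tG' is 1 + k', then the adjoint of the
compressed k' is -1 on e(Ran t)^⊥, and (Ran t)^⊥ = Ker t*.

Conversely, finite orthonormal bases give projections p, q ∈ K(E) onto Ker t and (Ran t)^⊥.
Inverting t from the complement of Ker t onto Ran t yields one G with Gt = 1 - p on Dom t and tG = 1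
- q (`exists_generalizedInverse`). It is adjointable because every bounded module map over the
compact operators is (`isAdjointable_of_map_op_smul`). -/

namespace HilbertModule

/-! ### The module action and finite-rank projections. -/

section ModuleAction

variable {A E : Type*} [NonUnitalCStarAlgebra A] [PartialOrder A]
  [NormedAddCommGroup E] [NormedSpace ℂ E] [SMul A E] [CStarModule A E]

theorem mul_op_smul (a b : A) (x : E) : (a * b) • x = a • b • x :=
  ext_inner (A := A) fun w => by simp [mul_assoc]

theorem op_smul_add (a : A) (x y : E) : a • (x + y) = a • x + a • y :=
  ext_inner (A := A) fun w => by simp [mul_add]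

theorem op_smul_sub (a : A) (x y : E) : a • (x - y) = a • x - a • y :=
  ext_inner (A := A) fun w => by simp [mul_sub]

theorem op_smul_zero (a : A) : a • (0 : E) = 0 :=
  ext_inner (A := A) fun w => by simp

theorem add_op_smul (a b : A) (x : E) : (a + b) • x = a • x + b • x :=
  ext_inner (A := A) fun w => by simp [add_mul]

theorem zero_op_smul (x : E) : (0 : A) • x = 0 :=
  ext_inner (A := A) fun w => by simp

theorem op_smul_smul (a : A) (c : ℂ) (x : E) : a • c • x = c • a • x :=
  ext_inner (A := A) fun w => by simp [mul_smul_comm]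

theorem smul_op_smul (a : A) (c : ℂ) (x : E) : (c • a) • x = c • a • x :=
  ext_inner (A := A) fun w => by simp [smul_mul_assoc]

theorem sum_op_smul {ι : Type*} (s : Finset ι) (a : ι → A) (x : E) :
    (∑ i ∈ s, a i) • x = ∑ i ∈ s, a i • x :=
  ext_inner (A := A) fun w => by simp [Finset.sum_mul]

theorem op_smul_sum {ι : Type*} (s : Finset ι) (a : A) (x : ι → E) :
    a • ∑ i ∈ s, x i = ∑ i ∈ s, a • x i :=
  ext_inner (A := A) fun w => by simp [Finset.mul_sum]

variable (A E) in
/-- The module action as a bilinear map. -/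
def opSMulL : A →L[ℂ] E →L[ℂ] E :=
  LinearMap.mkContinuous₂ (LinearMap.mk₂ ℂ (fun (a : A) (x : E) => a • x)
    add_op_smul (fun c a x => smul_op_smul a c x) op_smul_add (fun c a x => op_smul_smul a c x)) 1
    (fun a x => by simpa using norm_smul_le' A a x)

variable (A) in
/-- The linear subspace `X` is stable under the action of `A`. -/
def IsStable (X : Submodule ℂ E) : Prop := ∀ (a : A), ∀ x ∈ X, a • x ∈ X

theorem IsStable.topologicalClosure {X : Submodule ℂ E} (hX : IsStable A X) :
    IsStable A X.topologicalClosure := fun a _ hx =>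
  map_mem_closure (opSMulL A E a).continuous hx fun y hy => hX a y hy

variable (A) in
theorem isStable_generatedSubmodule (B : Set E) : IsStable A (generatedSubmodule A B) := by
  intro a x hx
  have : generatedSubmodule A B ≤
      (generatedSubmodule A B).comap (opSMulL A E a : E →ₗ[ℂ] E) := by
    refine Submodule.span_le.2 ?_
    rintro y (hy | ⟨b, z, hz, rfl⟩)
    · exact Submodule.subset_span (Or.inr ⟨a, y, hy, rfl⟩)
    · exact Submodule.subset_span (Or.inr ⟨a * b, z, hz, (mul_op_smul a b z).symm⟩)
  exact this hx

theorem inner_self_op_smul_self {x : E} (hx : IsMinimalProjection ⟪x, x⟫_A) :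
    ⟪x, x⟫_A • x = x := by
  have h := hx.1.isIdempotentElem.eq
  rw [← sub_eq_zero, ← CStarModule.inner_self (A := A)]
  simp [h]

theorem IsAdjointable.map_op_smul {T : E →L[ℂ] E} (hT : IsAdjointable A T) (a : A) (x : E) :
    T (a • x) = a • T x := by
  obtain ⟨S, hS⟩ := hT
  exact ext_inner (A := A) fun w => by simp [hS]

variable [StarOrderedRing A]

@[simp]
theorem theta_apply (x y z : E) : theta A x y z = ⟪x, z⟫_A • y := rfl

variable (A) in
theorem theta_mem_moduleCompacts (x y : E) : theta A x y ∈ moduleCompacts A E :=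
  Submodule.le_topologicalClosure _ (Submodule.subset_span ⟨x, y, rfl⟩)

variable (A) in
/-- The orthogonal projection onto a closed submodule with a finite orthonormal basis. -/
theorem exists_projection_of_finiteOrthonormalDim {X : Submodule ℂ E} (hX : IsStable A X)
    (hd : FiniteOrthonormalDim A X) :
    ∃ p : E →L[ℂ] E, p ∈ moduleCompacts A E ∧ (∀ z, p z ∈ X) ∧ (∀ z ∈ X, p z = z) ∧
      ∀ z w, ⟪p z, w⟫_A = ⟪z, p w⟫_A := by
  obtain ⟨n, B, ⟨hBX, ⟨hB, hB'⟩, hgen⟩, hn⟩ := hd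
  have hfin : B.Finite := by
    rw [← Set.finite_coe_iff, ← Cardinal.lt_aleph0_iff_finite, hn]
    exact Cardinal.natCast_lt_aleph0
  -- The Fourier sum over the basis; finiteness of B puts it in K(E).
  refine ⟨∑ x ∈ hfin.toFinset, theta A x x,
    Submodule.sum_mem _ fun x _ => theta_mem_moduleCompacts A x x, fun z => ?_, fun z hz => ?_,
    fun z w => ?_⟩
  · rw [sum_apply]
    exact Submodule.sum_mem _ fun x hx => hX _ _ (hBX (hfin.mem_toFinset.1 hx))
  · have hb : ∀ b ∈ B, (∑ x ∈ hfin.toFinset, theta A x x) b = b := by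
      intro b hb
      rw [sum_apply, Finset.sum_eq_single b]
      · exact inner_self_op_smul_self (hB b hb)
      · intro x hx hxb
        rw [theta_apply, hB' b hb x (hfin.mem_toFinset.1 hx) hxb.symm, zero_op_smul]
      · intro h
        exact absurd (hfin.mem_toFinset.2 hb) h
    have hlin : ∀ (a : A) (y : E), (∑ x ∈ hfin.toFinset, theta A x x) (a • y) =
        a • (∑ x ∈ hfin.toFinset, theta A x x) y := by
      intro a y
      simp [mul_op_smul, op_smul_sum]
    have hcl : IsClosed {y | (∑ x ∈ hfin.toFinset, theta A x x) y = y} :=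
      isClosed_eq (ContinuousLinearMap.continuous _) continuous_id
    refine closure_minimal (t := {y | (∑ x ∈ hfin.toFinset, theta A x x) y = y}) ?_ hcl (hgen hz)
    change generatedSubmodule A B ≤ LinearMap.eqLocus
      ((∑ x ∈ hfin.toFinset, theta A x x : E →L[ℂ] E) : E →ₗ[ℂ] E) LinearMap.id
    refine Submodule.span_le.2 ?_
    rintro y (hy | ⟨b, z, hz, rfl⟩)
    · exact hb y hy
    · exact (hlin b z).trans (by rw [hb z hz]; rfl)
  · simp

end ModuleAction

end HilbertModule

/-! ### Rank one operators on H. -/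

section RankOne

variable {H : Type*} [NormedAddCommGroup H] [InnerProductSpace ℂ H] [CompleteSpace H]

/-- The rank one operator `ζ' ↦ ⟪ζ, ζ'⟫ η`, as a compact operator. -/
def ketBra (η ζ : H) : compactOperators H :=
  ⟨InnerProductSpace.rankOne ℂ η ζ,
    (isCompactOperator_of_locallyCompactSpace_dom (innerSL ℂ ζ)).clm_comp
      (ContinuousLinearMap.toSpanSingleton ℂ η)⟩

@[simp]
theorem coe_ketBra (η ζ : H) :
    (ketBra η ζ : H →L[ℂ] H) = InnerProductSpace.rankOne ℂ η ζ := rfl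

theorem ketBra_mul_mul_ketBra (α β γ δ : H) (a : compactOperators H) :
    ketBra α β * a * ketBra γ δ = ⟪β, (a : H →L[ℂ] H) γ⟫_ℂ • ketBra α δ := by
  ext v
  simp [smul_smul, mul_comm]

theorem ketBra_mul_ketBra (α β γ δ : H) :
    ketBra α β * ketBra γ δ = ⟪β, γ⟫_ℂ • ketBra α δ := by
  ext v
  simp [smul_smul, mul_comm]

@[simp]
theorem star_ketBra (η ζ : H) : star (ketBra η ζ) = ketBra ζ η := by
  apply Subtype.ext
  simp [ContinuousLinearMap.star_eq_adjoint]

theorem norm_ketBra (η ζ : H) : ‖ketBra η ζ‖ = ‖η‖ * ‖ζ‖ :=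
  InnerProductSpace.norm_rankOne η ζ

/-- Taking η = av gives |ξ⟩⟨av|av = ‖av‖² ξ. -/
theorem eq_zero_of_forall_ketBra_mul_eq_zero {ξ : H} (hξ : ξ ≠ 0) {a : compactOperators H}
    (h : ∀ η, ketBra ξ η * a = 0) : a = 0 := by
  ext v
  have h1 : (ketBra ξ ((a : H →L[ℂ] H) v) * a : compactOperators H).1 v = 0 := by
    rw [h]; rfl
  simpa [hξ] using h1

theorem exists_finiteDimensional_norm_sub_starProjection_mul_le (a : compactOperators H) {ε : ℝ}
    (hε : 0 < ε) : ∃ U : Submodule ℂ H, ∃ _ : FiniteDimensional ℂ U,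
      ‖(a : H →L[ℂ] H) - U.starProjection * a‖ ≤ ε := by
  have hK := (IsCompactOperator.isCompact_closure_image_closedBall
    (f := ((a : H →L[ℂ] H) : H →ₗ[ℂ] H)) a.2 1).totallyBounded.subset subset_closure
  obtain ⟨t, htf, hcov⟩ := Metric.totallyBounded_iff.1 hK ε hε
  have : FiniteDimensional ℂ (Submodule.span ℂ t) := FiniteDimensional.span_of_finite ℂ htf
  refine ⟨Submodule.span ℂ t, this, ContinuousLinearMap.opNorm_le_of_unit_norm hε.le ?_⟩
  intro u hu
  obtain ⟨y, hy, huy⟩ := Set.mem_iUnion₂.1 (hcov ⟨u, by simp [hu], rfl⟩)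
  have hy' : (Submodule.span ℂ t).starProjection y = y :=
    Submodule.starProjection_eq_self_iff.2 (Submodule.subset_span hy)
  -- U is spanned by a finite ε-net of the image of the unit ball; the net point y near au is killed
  -- by 1 - P, so only au - y contributes.
  have h1 : ((a : H →L[ℂ] H) - (Submodule.span ℂ t).starProjection * a) u =
      (Submodule.span ℂ t)ᗮ.starProjection ((a : H →L[ℂ] H) u - y) := by
    rw [Submodule.starProjection_orthogonal]
    simp [hy']
  rw [h1]
  refine (Submodule.norm_starProjection_apply_le _ _).trans ?_
  exact (mem_ball_iff_norm.1 huy).le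

end RankOne

namespace HilbertModule

/-! ### Reduction to the slices |ξ⟩⟨η|x. -/

section Slices

variable {H : Type*} [NormedAddCommGroup H] [InnerProductSpace ℂ H] [CompleteSpace H]
  {E : Type*} [NormedAddCommGroup E] [NormedSpace ℂ E]
  [SMul (compactOperators H) E] [CStarModule (compactOperators H) E]

/-- For a projection p, ‖x - px‖² = ‖(1 - p)⟪x, x⟫(1 - p)‖, and compactness of ⟪x, x⟫ makes this
small for some p of finite rank. An orthonormal basis of the range of p splits p into operators
|η⟩⟨η|. -/
theorem mem_closure_span_ketBra_smul (x : E) :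
    x ∈ closure (Submodule.span ℂ {z | ∃ η : H, z = ketBra η η • x} : Set E) := by
  refine Metric.mem_closure_iff.2 fun ε hε => ?_
  obtain ⟨U, hU, hUε⟩ := exists_finiteDimensional_norm_sub_starProjection_mul_le
    (⟪x, x⟫_(compactOperators H)) (show 0 < ε ^ 2 / 2 by positivity)
  let b := stdOrthonormalBasis ℂ U
  let p : compactOperators H := ∑ i, ketBra (b i : H) (b i : H)
  have hp : (p : H →L[ℂ] H) = U.starProjection := by
    rw [b.starProjection_eq_sum_rankOne]
    simp [p]
  have hps : star p = p := by simp [p]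
  refine ⟨p • x, ?_, ?_⟩
  · simp only [p, sum_op_smul]
    exact Submodule.sum_mem _ fun i _ => Submodule.subset_span ⟨_, rfl⟩
  · have h1 : (⟪x - p • x, x - p • x⟫_(compactOperators H) : H →L[ℂ] H) =
        ((⟪x, x⟫_(compactOperators H) : H →L[ℂ] H) -
          U.starProjection * (⟪x, x⟫_(compactOperators H) : H →L[ℂ] H)) * Uᗮ.starProjection := by
      simp [hps, hp, mul_sub, sub_mul, mul_assoc, Submodule.starProjection_orthogonal']
      abel
    have h2 : ‖x - p • x‖ ^ 2 < ε ^ 2 := by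
      rw [CStarModule.norm_sq_eq (compactOperators H)]
      change ‖(⟪x - p • x, x - p • x⟫_(compactOperators H) : H →L[ℂ] H)‖ < _
      rw [h1]
      calc _ ≤ ε ^ 2 / 2 * 1 := (norm_mul_le _ _).trans
            (mul_le_mul hUε (Submodule.starProjection_norm_le _) (norm_nonneg _) (by positivity))
        _ < ε ^ 2 := by nlinarith
    rw [dist_eq_norm]
    exact lt_of_pow_lt_pow_left₀ 2 hε.le h2

variable (ξ : Metric.sphere (0 : H) 1)

theorem ketBra_smul_ketBra_smul (η ζ : H) (x : E) :
    ketBra η (ξ : H) • ketBra (ξ : H) ζ • x = ketBra η ζ • x := by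
  rw [← mul_op_smul, ketBra_mul_ketBra]
  simp

/-- Membership in a closed submodule can be tested on the slices `|ξ⟩⟨η| x`. -/
theorem mem_of_forall_ketBra_smul_mem {X : Submodule ℂ E} (hX : IsStable (compactOperators H) X)
    (hc : IsClosed (X : Set E)) {x : E} (h : ∀ η : H, ketBra (ξ : H) η • x ∈ X) : x ∈ X := by
  refine closure_minimal ?_ hc (mem_closure_span_ketBra_smul (H := H) x)
  refine Submodule.span_le.2 ?_
  rintro _ ⟨η, rfl⟩
  -- |η⟩⟨η| factors as |η⟩⟨ξ| · |ξ⟩⟨η|, so stability recovers it from a slice.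
  rw [← ketBra_smul_ketBra_smul ξ]
  exact hX _ _ (h η)

/-- Writing ⟪x, x⟫ = s*s, the slice at η has norm ‖sη‖, while ‖x‖ = ‖s‖. -/
theorem norm_le_of_forall_norm_ketBra_smul_le {x : E} {C : ℝ} (hC : 0 ≤ C)
    (h : ∀ η : H, ‖η‖ = 1 → ‖ketBra (ξ : H) η • x‖ ≤ C) : ‖x‖ ≤ C := by
  have h0 : (0 : H →L[ℂ] H) ≤ (⟪x, x⟫_(compactOperators H) : H →L[ℂ] H) :=
    CStarModule.inner_self_nonneg (A := compactOperators H) (x := x)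
  obtain ⟨s, hs⟩ := CStarAlgebra.nonneg_iff_eq_star_mul_self.1 h0
  have hsC : ‖s‖ ≤ C := by
    refine ContinuousLinearMap.opNorm_le_of_unit_norm hC fun η hη => ?_
    have h1 := pow_le_pow_left₀ (norm_nonneg _) (h η hη) 2
    rw [CStarModule.norm_sq_eq (compactOperators H)] at h1
    simp only [CStarModule.inner_op_smul_right, CStarModule.inner_op_smul_left, star_ketBra] at h1
    rw [← mul_assoc, ketBra_mul_mul_ketBra, hs, norm_smul, norm_ketBra] at h1
    have h2 : ⟪η, (star s * s : H →L[ℂ] H) η⟫_ℂ = (‖s η‖ : ℂ) ^ 2 := by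
      simp [ContinuousLinearMap.star_eq_adjoint, ContinuousLinearMap.adjoint_inner_right]
    rw [h2] at h1
    simp at h1
    exact le_of_sq_le_sq h1 hC
  have h3 : ‖x‖ ^ 2 ≤ C ^ 2 := by
    rw [CStarModule.norm_sq_eq (compactOperators H)]
    change ‖(⟪x, x⟫_(compactOperators H) : H →L[ℂ] H)‖ ≤ _
    rw [hs, CStarRing.norm_star_mul_self]
    nlinarith [norm_nonneg s]
  exact le_of_sq_le_sq h3 hC

end Slices

/-! ### The Hilbert space eE and compressions to it. -/

section Corner

variable {H : Type*} [NormedAddCommGroup H] [InnerProductSpace ℂ H] [CompleteSpace H]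
  (E : Type*) [NormedAddCommGroup E] [NormedSpace ℂ E]
  [SMul (compactOperators H) E] [CStarModule (compactOperators H) E]
  (ξ : Metric.sphere (0 : H) 1)

/-- The subspace `e E`, where `e` is the minimal projection `|ξ⟩⟨ξ|`. -/
def corner : Submodule ℂ E :=
  LinearMap.eqLocus (opSMulL (compactOperators H) E (ketBra ξ ξ) : E →ₗ[ℂ] E) LinearMap.id

variable {E}

theorem mem_corner {x : E} : x ∈ corner E ξ ↔ ketBra (ξ : H) ξ • x = x := Iff.rfl

theorem isClosed_corner : IsClosed (corner E ξ : Set E) :=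
  isClosed_eq (opSMulL (compactOperators H) E (ketBra ξ ξ)).continuous continuous_id

instance [CompleteSpace E] : CompleteSpace (corner E ξ) :=
  (isClosed_corner ξ).completeSpace_coe

theorem ketBra_smul_mem_corner (η : H) (x : E) : ketBra (ξ : H) η • x ∈ corner E ξ :=
  ketBra_smul_ketBra_smul ξ ξ η x

theorem inner_corner (x y : corner E ξ) : ⟪(x : E), (y : E)⟫_(compactOperators H) =
    ⟪(ξ : H), (⟪(x : E), (y : E)⟫_(compactOperators H) : H →L[ℂ] H) ξ⟫_ℂ • ketBra (ξ : H) ξ := by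
  rw [← ketBra_mul_mul_ketBra]
  nth_rw 1 [← (mem_corner ξ).1 x.2, ← (mem_corner ξ).1 y.2]
  simp [mul_assoc]

/-- `e E` is a Hilbert space with `⟪x, y⟫_A = ⟪x, y⟫_ℂ e`. -/
instance : InnerProductSpace ℂ (corner E ξ) where
  inner x y := ⟪(ξ : H), (⟪(x : E), (y : E)⟫_(compactOperators H) : H →L[ℂ] H) ξ⟫_ℂ
  norm_sq_eq_re_inner x := by
    have h0 : (0 : H →L[ℂ] H) ≤ (⟪(x : E), (x : E)⟫_(compactOperators H) : H →L[ℂ] H) :=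
      CStarModule.inner_self_nonneg (A := compactOperators H) (x := (x : E))
    have h1 := ((ContinuousLinearMap.nonneg_iff_isPositive _).1 h0).inner_nonneg_right (ξ : H)
    have h2 := congrArg norm (inner_corner ξ x x)
    rw [norm_smul, norm_ketBra, ← CStarModule.norm_sq_eq] at h2
    rw [show ‖x‖ = ‖(x : E)‖ from rfl, h2]
    have h3 := congrArg Complex.re (Complex.norm_of_nonneg' h1)
    simpa using h3
  conj_inner_symm x y := by
    rw [← CStarModule.star_inner (y : E) (x : E), inner_conj_symm]
    exact (ContinuousLinearMap.adjoint_inner_right _ _ _).symm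
  add_left x y z := by simp
  smul_left x y r := by simp

theorem inner_corner_eq_smul (x y : corner E ξ) :
    ⟪(x : E), (y : E)⟫_(compactOperators H) = ⟪x, y⟫_ℂ • ketBra (ξ : H) ξ :=
  inner_corner ξ x y

theorem isMinimalProjection_ketBra : IsMinimalProjection (ketBra (ξ : H) ξ) := by
  refine ⟨⟨?_, star_ketBra _ _⟩, ?_, fun a => ⟨_, ketBra_mul_mul_ketBra _ _ _ _ a⟩⟩
  · simp [IsIdempotentElem, ketBra_mul_ketBra]
  · rw [← norm_ne_zero_iff, norm_ketBra]
    simp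

/-- The map `x ↦ |ξ⟩⟨η| x` from `E` to `e E`. -/
def slice (η : H) : E →L[ℂ] corner E ξ :=
  (opSMulL (compactOperators H) E (ketBra ξ η)).codRestrict _ (ketBra_smul_mem_corner ξ η)

@[simp]
theorem coe_slice (η : H) (x : E) : (slice ξ η x : E) = ketBra (ξ : H) η • x := rfl

theorem slice_coe (x : corner E ξ) : slice ξ (ξ : H) (x : E) = x :=
  Subtype.ext x.2

/-- Inner products with elements of `e E` are determined by those in the Hilbert space `e E`. -/
theorem inner_eq_inner_of_forall_slice {x y : E} {u v : corner E ξ}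
    (h : ∀ η : H, ⟪u, slice ξ η x⟫_ℂ = ⟪v, slice ξ η y⟫_ℂ) :
    ⟪(u : E), x⟫_(compactOperators H) = ⟪(v : E), y⟫_(compactOperators H) := by
  rw [← sub_eq_zero]
  refine eq_zero_of_forall_ketBra_mul_eq_zero (ξ := (ξ : H)) (ne_zero_of_mem_unit_sphere ξ) ?_
  intro η
  rw [mul_sub, ← CStarModule.inner_op_smul_right, ← CStarModule.inner_op_smul_right,
    ← coe_slice, ← coe_slice, inner_corner_eq_smul, inner_corner_eq_smul, h, sub_self]

/-- The compression of an operator on `E` to `e E`. -/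
def compression (T : E →L[ℂ] E) : corner E ξ →L[ℂ] corner E ξ :=
  slice ξ (ξ : H) ∘L T ∘L (corner E ξ).subtypeL

/-- A module map commutes with e, so it already preserves eE. -/
theorem coe_compression {T : E →L[ℂ] E}
    (hT : ∀ (a : compactOperators H) (x : E), T (a • x) = a • T x) (x : corner E ξ) :
    (compression ξ T x : E) = T x := by
  change ketBra (ξ : H) ξ • T x = T x
  rw [← hT, (mem_corner ξ).1 x.2]

variable [CompleteSpace E]

/-- The operator depends continuously and linearly on y, so y may be replaced by |η⟩⟨η|y. For z ∈ eE
one has ⟪x, z⟫ = e⟪x, z⟫, hence Θz is a scalar multiple of the fixed vector |ξ⟩⟨η|y: the restriction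
to eE has rank at most one. -/
theorem isCompactOperator_theta_comp_subtypeL (x y : E) :
    IsCompactOperator (theta (compactOperators H) x y ∘L (corner E ξ).subtypeL) := by
  let L : E →L[ℂ] corner E ξ →L[ℂ] E :=
    (ContinuousLinearMap.compL ℂ (corner E ξ) (compactOperators H) E).flip
      (CStarModule.innerSL x ∘L (corner E ξ).subtypeL) ∘L (opSMulL (compactOperators H) E).flip
  have hL : ∀ y z, L y z = ⟪x, (z : E)⟫_(compactOperators H) • y := fun y z => rfl
  have hcl : IsClosed {y | IsCompactOperator (L y)} :=
    isClosed_setOfPred_isCompactOperator.preimage L.continuous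
  refine closure_minimal (t := {y | IsCompactOperator (L y)}) ?_ hcl
    (mem_closure_span_ketBra_smul (H := H) y)
  change _ ≤ (compactOperator (RingHom.id ℂ) (corner E ξ) E).comap (L : E →ₗ[ℂ] _)
  refine Submodule.span_le.2 ?_
  rintro _ ⟨η, rfl⟩
  let f : corner E ξ →L[ℂ] ℂ :=
    ⟨{ toFun := fun z => ⟪(ξ : H), (⟪x, (z : E)⟫_(compactOperators H) : H →L[ℂ] H) η⟫_ℂ
       map_add' := fun z w => by simp
       map_smul' := fun c z => by simp }, by
      have h1 : Continuous fun z : corner E ξ =>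
          (⟪x, (z : E)⟫_(compactOperators H) : H →L[ℂ] H) :=
        continuous_subtype_val.comp
          ((CStarModule.innerSL (A := compactOperators H) x).continuous.comp continuous_subtype_val)
      exact continuous_const.inner (h1.clm_apply continuous_const)⟩
  have hf : L (ketBra η η • y) =
      ContinuousLinearMap.toSpanSingleton ℂ (ketBra (ξ : H) η • y) ∘L f := by
    ext z
    have hz : ketBra (ξ : H) ξ * ⟪x, (z : E)⟫_(compactOperators H) =
        ⟪x, (z : E)⟫_(compactOperators H) := by
      rw [← CStarModule.inner_op_smul_right, (mem_corner ξ).1 z.2]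
    rw [hL, ← mul_op_smul, ← hz, ketBra_mul_mul_ketBra, smul_op_smul]
    rfl
  change IsCompactOperator (L (ketBra η η • y))
  rw [hf]
  exact (isCompactOperator_of_locallyCompactSpace_dom f).clm_comp
    (ContinuousLinearMap.toSpanSingleton ℂ (ketBra (ξ : H) η • y))

theorem isCompactOperator_compression {T : E →L[ℂ] E}
    (hT : T ∈ moduleCompacts (compactOperators H) E) : IsCompactOperator (compression ξ T) := by
  let R : (E →L[ℂ] E) →L[ℂ] corner E ξ →L[ℂ] E :=
    (ContinuousLinearMap.compL ℂ (corner E ξ) E E).flip (corner E ξ).subtypeL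
  have hcl : IsClosed {T | IsCompactOperator (R T)} :=
    isClosed_setOfPred_isCompactOperator.preimage R.continuous
  have hR : IsCompactOperator (R T) := by
    refine closure_minimal (t := {T | IsCompactOperator (R T)}) ?_ hcl hT
    change _ ≤ (compactOperator (RingHom.id ℂ) (corner E ξ) E).comap (R : (E →L[ℂ] E) →ₗ[ℂ] _)
    refine Submodule.span_le.2 ?_
    rintro _ ⟨x, y, rfl⟩
    exact isCompactOperator_theta_comp_subtypeL ξ x y
  exact hR.clm_comp (slice ξ (ξ : H))

end Corner

/-- The second projection is bounded below on the complete space Γ. -/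
theorem isClosed_map_snd_of_norm_le {F G : Type*} [NormedAddCommGroup F] [NormedSpace ℂ F]
    [CompleteSpace F] [NormedAddCommGroup G] [NormedSpace ℂ G] [CompleteSpace G]
    {Γ : Submodule ℂ (F × G)} (hΓ : IsClosed (Γ : Set (F × G))) {C : ℝ}
    (h : ∀ p ∈ Γ, ‖p.1‖ ≤ C * ‖p.2‖) :
    IsClosed (Γ.map (LinearMap.snd ℂ F G) : Set G) := by
  have : CompleteSpace Γ := hΓ.completeSpace_coe
  let f : Γ →L[ℂ] G := ContinuousLinearMap.snd ℂ F G ∘L Γ.subtypeL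
  -- The product carries the max norm, so the constant must dominate both coordinates.
  have hf : AntilipschitzWith (Real.toNNReal (max C 1)) f := by
    refine ContinuousLinearMap.antilipschitz_of_bound f fun p => ?_
    rw [Real.coe_toNNReal _ (zero_le_one.trans (le_max_right C 1))]
    refine max_le ((h p p.2).trans ?_) ?_
    · exact mul_le_mul_of_nonneg_right (le_max_left _ _) (norm_nonneg _)
    · exact le_mul_of_one_le_left (norm_nonneg _) (le_max_right _ _)
  convert hf.isClosed_range f.uniformContinuous using 1
  ext z
  simp [f]

/-! ### Automatic adjointability and finite dimension. -/

section Hilbert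

variable {H : Type*} [NormedAddCommGroup H] [InnerProductSpace ℂ H] [CompleteSpace H]
  {E : Type*} [NormedAddCommGroup E] [NormedSpace ℂ E]
  [SMul (compactOperators H) E] [CStarModule (compactOperators H) E]
  (ξ : Metric.sphere (0 : H) 1)

/-- Every bounded module map of a Hilbert module over the compact operators is adjointable. -/
theorem isAdjointable_of_map_op_smul [CompleteSpace E] (ξ : Metric.sphere (0 : H) 1) {T : E →L[ℂ] E}
    (hT : ∀ (a : compactOperators H) (x : E), T (a • x) = a • T x) :
    IsAdjointable (compactOperators H) T := by
  -- Γ consists of the pairs (T*y, y). Its second projection is closed because ‖T*y‖ ≤ ‖T‖‖y‖, and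
  -- contains every slice, where the Hilbert space adjoint of the compression supplies T*y.
  let Γ : Submodule ℂ (E × E) :=
    { carrier := {p | ∀ x, ⟪p.2, T x⟫_(compactOperators H) = ⟪p.1, x⟫_(compactOperators H)}
      add_mem' := fun {p q} hp hq x => by simp [hp x, hq x]
      zero_mem' := fun x => by simp
      smul_mem' := fun c p hp x => by simp [hp x] }
  have hΓ : IsClosed (Γ : Set (E × E)) := by
    change IsClosed {p : E × E | ∀ x, _ = _}
    simp only [Set.ofPred_forall]
    refine isClosed_iInter fun x => isClosed_eq ?_ ?_
    · exact CStarModule.continuous_inner.comp (continuous_snd.prodMk continuous_const)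
    · exact CStarModule.continuous_inner.comp (continuous_fst.prodMk continuous_const)
  have hbound : ∀ p ∈ Γ, ‖p.1‖ ≤ ‖T‖ * ‖p.2‖ := by
    intro p hp
    rcases (norm_nonneg p.1).eq_or_lt with h0 | h0
    · rw [← h0]; positivity
    refine le_of_mul_le_mul_right ?_ h0
    calc ‖p.1‖ * ‖p.1‖ = ‖⟪p.2, T p.1⟫_(compactOperators H)‖ := by
          rw [hp, ← CStarModule.norm_sq_eq, sq]
      _ ≤ ‖p.2‖ * (‖T‖ * ‖p.1‖) := (CStarModule.norm_inner_le E).trans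
          (mul_le_mul_of_nonneg_left (T.le_opNorm _) (norm_nonneg _))
      _ = ‖T‖ * ‖p.2‖ * ‖p.1‖ := by ring
  have hmem : ∀ y, y ∈ Γ.map (LinearMap.snd ℂ E E) := by
    intro y
    refine mem_of_forall_ketBra_smul_mem ξ ?_ (isClosed_map_snd_of_norm_le hΓ hbound) fun η => ?_
    · rintro a _ ⟨p, hp, rfl⟩
      refine ⟨(a • p.1, a • p.2), fun x => ?_, rfl⟩
      have := hp x
      simp [this]
    · refine ⟨(((compression ξ T).adjoint (slice ξ η y) : corner E ξ), slice ξ η y), ?_, rfl⟩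
      intro x
      refine inner_eq_inner_of_forall_slice ξ fun ζ => ?_
      rw [ContinuousLinearMap.adjoint_inner_left]
      congr 1
      apply Subtype.ext
      rw [coe_compression ξ hT, coe_slice, coe_slice, hT]
  choose p hp hp' using hmem
  exact ⟨fun y => (p y).1, fun x y => by
    have h := hp y x
    rwa [show (p y).2 = y from hp' y] at h⟩

/-- A submodule whose intersection with `e E` is finite-dimensional has finite orthonormal
dimension. -/
theorem finiteOrthonormalDim_of_finiteDimensional {X : Submodule ℂ E}
    (hX : IsStable (compactOperators H) X)
    (hfin : FiniteDimensional ℂ (X.comap (corner E ξ).subtype)) :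
    FiniteOrthonormalDim (compactOperators H) X := by
  let b := stdOrthonormalBasis ℂ (X.comap (corner E ξ).subtype)
  have hin : ∀ i j, ⟪((b i : corner E ξ) : E), ((b j : corner E ξ) : E)⟫_(compactOperators H) =
      if i = j then ketBra (ξ : H) ξ else 0 := by
    intro i j
    rw [inner_corner_eq_smul, ← Submodule.coe_inner, b.inner_eq_ite]
    split_ifs <;> simp
  -- A Hilbert space basis of eX is orthonormal in the module sense, since ⟪x, y⟫ is the scalar
  -- product times e. It generates X densely because all slices of elements of X lie in eX.
  let B : Set E := Set.range fun i => ((b i : corner E ξ) : E)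
  have hB : B.Finite := Set.finite_range _
  refine ⟨B.ncard, B, ⟨?_, ⟨?_, ?_⟩, ?_⟩, ?_⟩
  · rintro _ ⟨i, rfl⟩
    exact (b i).2
  · rintro _ ⟨i, rfl⟩
    simpa [hin] using isMinimalProjection_ketBra ξ
  · rintro _ ⟨i, rfl⟩ _ ⟨j, rfl⟩ hij
    have : j ≠ i := by rintro rfl; exact hij rfl
    simp [hin, this]
  · intro x hx
    refine mem_of_forall_ketBra_smul_mem ξ
      (isStable_generatedSubmodule (compactOperators H) B).topologicalClosure
      (Submodule.isClosed_topologicalClosure _) (x := x) fun η => ?_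
    refine Submodule.le_topologicalClosure _ ?_
    let y : X.comap (corner E ξ).subtype := ⟨slice ξ η x, hX _ _ hx⟩
    have hy := congrArg (fun z : X.comap (corner E ξ).subtype => ((z : corner E ξ) : E))
      (b.sum_repr y)
    have hy' : ketBra (ξ : H) η • x = ∑ i, b.repr y i • ((b i : corner E ξ) : E) := by
      rw [show ketBra (ξ : H) η • x = ((y : corner E ξ) : E) from rfl]
      simpa using hy.symm
    rw [hy']
    exact Submodule.sum_mem _ fun i _ =>
      Submodule.smul_mem _ _ (Submodule.subset_span (Or.inl ⟨i, rfl⟩))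
  · exact (Set.cast_ncard hB).symm

theorem finiteOrthonormalDim_of_compact_eigenvector [CompleteSpace E] {X : Submodule ℂ E}
    (hX : IsStable (compactOperators H) X) {k : corner E ξ →L[ℂ] corner E ξ}
    (hk : IsCompactOperator k) (h : ∀ x : corner E ξ, (x : E) ∈ X → k x = -x) :
    FiniteOrthonormalDim (compactOperators H) X := by
  refine finiteOrthonormalDim_of_finiteDimensional ξ hX ?_
  have := ContinuousLinearMap.finite_dimensional_eigenspace hk (-1) (by simp)
  refine Submodule.finiteDimensional_of_le (S₂ := Module.End.eigenspace k.toLinearMap (-1)) ?_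
  intro x hx
  rw [Module.End.mem_eigenspace_iff]
  simpa using h x hx

end Hilbert

/-! ### Module relations and orthogonal complements. -/

section LinearRelation

variable (A : Type*) {E : Type*} [NormedAddCommGroup E] [NormedSpace ℂ E] [SMul A E]

/-- Stability of a linear relation on `E` under the action of `A`. -/
def IsStableGraph (Γ : Submodule ℂ (E × E)) : Prop :=
  ∀ (a : A), ∀ q ∈ Γ, (a • q.1, a • q.2) ∈ Γ

variable {A} in
theorem IsStableGraph.isStable_ran {Γ : Submodule ℂ (E × E)} (hΓ : IsStableGraph A Γ) :
    IsStable A (Γ.map (LinearMap.snd ℂ E E)) := by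
  rintro a _ ⟨q, hq, rfl⟩
  exact ⟨_, hΓ a q hq, rfl⟩

variable {A} in
theorem IsModuleLinear.isStableGraph {t : E →ₗ.[ℂ] E} (ht : IsModuleLinear A t) :
    IsStableGraph A t.graph := by
  rintro a ⟨x, z⟩ hq
  obtain ⟨x', rfl, rfl⟩ := (LinearPMap.mem_graph_iff _).1 hq
  obtain ⟨h, h'⟩ := ht a x'
  exact (LinearPMap.mem_graph_iff _).2 ⟨⟨_, h⟩, rfl, h'⟩

theorem sub_fst_mem {Γ : Submodule ℂ (E × E)} {w : E × E} (hw : w ∈ Γ) {x : E}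
    (hx : (x, (0 : E)) ∈ Γ) : (w.1 - x, w.2) ∈ Γ := by
  have h := Γ.sub_mem hw hx
  rwa [show w - (x, (0 : E)) = (w.1 - x, w.2) from Prod.ext rfl (sub_zero _)] at h

end LinearRelation

section Perp

variable (A : Type*) {E : Type*} [NonUnitalCStarAlgebra A] [PartialOrder A]
  [NormedAddCommGroup E] [NormedSpace ℂ E] [SMul A E] [CStarModule A E]

/-- The orthogonal complement of `X`. -/
def perp (X : Submodule ℂ E) : Submodule ℂ E where
  carrier := {y | ∀ x ∈ X, ⟪y, x⟫_A = 0}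
  add_mem' hy hz x hx := by simp [hy x hx, hz x hx]
  zero_mem' x _ := by simp
  smul_mem' c y hy x hx := by simp [hy x hx]

theorem isStable_perp (X : Submodule ℂ E) : IsStable A (perp A X) := fun a y hy x hx => by
  simp [hy x hx]

variable {A} in
theorem IsStableGraph.isStable_ker {Γ : Submodule ℂ (E × E)} (hΓ : IsStableGraph A Γ) :
    IsStable A (Γ.comap (LinearMap.inl ℂ E E)) := fun a x hx => by
  have h := hΓ a _ hx
  simpa [op_smul_zero] using h

end Perp

/-! ### Fredholm theory for closed module relations. -/

section Graph

variable {H : Type*} [NormedAddCommGroup H] [InnerProductSpace ℂ H] [CompleteSpace H]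
  {E : Type*} [NormedAddCommGroup E] [NormedSpace ℂ E] [CompleteSpace E]
  [SMul (compactOperators H) E] [CStarModule (compactOperators H) E]

/-- X^⊥⊥ = X is inherited from the Hilbert space eE: a vector of eE orthogonal to eX is orthogonal
to all of X, and the slices of z then lie in (eX)^⊥⊥ = eX. -/
theorem mem_of_inner_perp_eq_zero (ξ : Metric.sphere (0 : H) 1)
    {X : Submodule ℂ E} (hX : IsStable (compactOperators H) X)
    (hc : IsClosed (X : Set E)) {z : E}
    (hz : ∀ y ∈ perp (compactOperators H) X, ⟪y, z⟫_(compactOperators H) = 0) : z ∈ X := by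
  refine mem_of_forall_ketBra_smul_mem ξ hX hc fun η => ?_
  let Xc : Submodule ℂ (corner E ξ) := X.comap (corner E ξ).subtype
  have hXc : IsClosed (Xc : Set (corner E ξ)) := hc.preimage continuous_subtype_val
  have : CompleteSpace Xc := hXc.completeSpace_coe
  suffices h : slice ξ η z ∈ Xcᗮᗮ by
    rw [Submodule.orthogonal_orthogonal] at h
    exact h
  intro v hv
  have hv' : (v : E) ∈ perp (compactOperators H) X := fun x hx => by
    have := inner_eq_inner_of_forall_slice ξ (x := x) (y := x) (u := v) (v := 0) fun ζ => by
      rw [inner_zero_left]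
      exact Submodule.inner_left_of_mem_orthogonal
        (show slice ξ ζ x ∈ Xc from hX _ _ hx) hv
    simpa using this
  have h0 := inner_corner_eq_smul ξ v (slice ξ η z)
  rw [coe_slice, CStarModule.inner_op_smul_right, hz _ hv', mul_zero] at h0
  exact (smul_eq_zero.1 h0.symm).resolve_right (isMinimalProjection_ketBra ξ).2.1

/-- Otherwise there are unit vectors u_n ∈ eE with p u_n = 0 and images z_n → 0. As u_n = G z_n - k
u_n in eE and k compresses to a compact operator, a subsequence converges to a unit vector of the
kernel that p kills, although p fixes the kernel. The bound is confined to eE because k need not be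
compact on E. -/
theorem exists_norm_le_of_mem_corner (ξ : Metric.sphere (0 : H) 1)
    {Γ : Submodule ℂ (E × E)} (hc : IsClosed (Γ : Set (E × E)))
    {G k p : E →L[ℂ] E} (hk : k ∈ moduleCompacts (compactOperators H) E)
    (hG : ∀ q ∈ Γ, G q.2 = q.1 + k q.1) (hp : ∀ x, (x, (0 : E)) ∈ Γ → p x = x) :
    ∃ C : ℝ, 0 ≤ C ∧ ∀ q ∈ Γ, q.1 ∈ corner E ξ → p q.1 = 0 → ‖q.1‖ ≤ C * ‖q.2‖ := by
  by_contra! hcon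
  have hunit : ∀ n : ℕ, ∃ u : corner E ξ, ∃ z : E,
      ((u : E), z) ∈ Γ ∧ p u = 0 ∧ ‖u‖ = 1 ∧ ‖z‖ ≤ 1 / ((n : ℝ) + 1) := by
    intro n
    obtain ⟨q, hq, hqc, hpq, hlt⟩ := hcon ((n : ℝ) + 1) (by positivity)
    have hpos : 0 < ‖q.1‖ := lt_of_le_of_lt (by positivity) hlt
    refine ⟨((‖q.1‖⁻¹ : ℝ) : ℂ) • ⟨q.1, hqc⟩, ((‖q.1‖⁻¹ : ℝ) : ℂ) • q.2,
      Γ.smul_mem _ hq, ?_, ?_, ?_⟩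
    · simp [hpq]
    · rw [norm_smul]
      change _ * ‖q.1‖ = 1
      simp [hpos.ne']
    · rw [norm_smul, Complex.norm_real, norm_inv, norm_norm, le_div_iff₀ (by positivity),
        inv_mul_eq_div, div_mul_eq_mul_div, div_le_one hpos, mul_comm]
      exact hlt.le
  choose u z huz hpu hu hz using hunit
  have hz0 : Filter.Tendsto z Filter.atTop (nhds 0) :=
    squeeze_zero_norm hz tendsto_one_div_add_atTop_nhds_zero_nat
  obtain ⟨K, hK, hKs⟩ := (isCompactOperator_compression ξ hk).image_closedBall_subset_compact
    (f := (compression ξ k : corner E ξ →ₗ[ℂ] corner E ξ)) 1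
  obtain ⟨v, -, φ, hφ, hv⟩ := hK.tendsto_subseq (x := fun n => compression ξ k (u n))
    fun n => hKs ⟨u n, by simp [hu n], rfl⟩
  have heq : ∀ n, u n = slice ξ (ξ : H) (G (z n)) - compression ξ k (u n) := by
    intro n
    rw [hG _ (huz n), map_add, slice_coe]
    simp [compression]
  have hlim : Filter.Tendsto (fun n => u (φ n)) Filter.atTop (nhds (-v)) := by
    have h1 : Filter.Tendsto (fun n => slice ξ (ξ : H) (G (z (φ n)))) Filter.atTop (nhds 0) := by
      have h2 := ((slice ξ (ξ : H) ∘L G).continuous.tendsto 0).comp (hz0.comp hφ.tendsto_atTop)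
      rw [map_zero] at h2
      exact h2
    have h3 := h1.sub hv
    rw [zero_sub] at h3
    exact h3.congr fun n => (heq (φ n)).symm
  have hlimE : Filter.Tendsto (fun n => (u (φ n) : E)) Filter.atTop
      (nhds ((-v : corner E ξ) : E)) :=
    (continuous_subtype_val.tendsto _).comp hlim
  have hmem : (((-v : corner E ξ) : E), (0 : E)) ∈ Γ :=
    hc.mem_of_tendsto (hlimE.prodMk_nhds (hz0.comp hφ.tendsto_atTop))
      (Filter.Eventually.of_forall fun n => huz (φ n))
  have hp0 : p ((-v : corner E ξ) : E) = 0 := by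
    refine tendsto_nhds_unique ((p.continuous.tendsto _).comp hlimE) ?_
    exact tendsto_const_nhds.congr fun n => (hpu (φ n)).symm
  have hnorm : ‖-v‖ = 1 := by
    refine tendsto_nhds_unique hlim.norm ?_
    exact tendsto_const_nhds.congr fun n => (hu (φ n)).symm
  rw [hp _ hmem] at hp0
  rw [show -v = 0 from Subtype.ext hp0] at hnorm
  simp at hnorm

theorem isClosed_ran_of_leftInverse (ξ : Metric.sphere (0 : H) 1)
    {Γ : Submodule ℂ (E × E)} (hc : IsClosed (Γ : Set (E × E)))
    (hs : IsStableGraph (compactOperators H) Γ)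
    {G k p : E →L[ℂ] E} (hk : k ∈ moduleCompacts (compactOperators H) E)
    (hG : ∀ q ∈ Γ, G q.2 = q.1 + k q.1) (hp : ∀ x, (x, (0 : E)) ∈ Γ → p x = x)
    (hp' : ∀ x, (p x, (0 : E)) ∈ Γ)
    (hlin : ∀ (a : compactOperators H) (x : E), p (a • x) = a • p x) :
    IsClosed (Γ.map (LinearMap.snd ℂ E E) : Set E) := by
  obtain ⟨C, hC, hbound⟩ := exists_norm_le_of_mem_corner ξ hc hk hG hp
  -- Replacing (x, z) by (x - px, z) shows that Γ' has the same range as Γ; on Γ' the lower bound is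
  -- available.
  let Γ' : Submodule ℂ (E × E) := Γ ⊓ LinearMap.ker ((p : E →ₗ[ℂ] E) ∘ₗ LinearMap.fst ℂ E E)
  have hΓ' : IsClosed (Γ' : Set (E × E)) :=
    hc.inter (isClosed_singleton.preimage (p.continuous.comp continuous_fst))
  have hmap : Γ.map (LinearMap.snd ℂ E E) = Γ'.map (LinearMap.snd ℂ E E) := by
    refine le_antisymm ?_ (Submodule.map_mono inf_le_left)
    rintro _ ⟨q, hq, rfl⟩
    refine ⟨(q.1 - p q.1, q.2), ⟨?_, ?_⟩, rfl⟩
    · exact sub_fst_mem hq (hp' q.1)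
    · simp [hp _ (hp' q.1)]
  rw [hmap]
  refine isClosed_map_snd_of_norm_le hΓ' (C := C) fun q hq => ?_
  refine norm_le_of_forall_norm_ketBra_smul_le ξ (by positivity) fun η hη => ?_
  have hpq : p q.1 = 0 := hq.2
  refine (hbound _ (hs (ketBra (ξ : H) η) q hq.1) (ketBra_smul_mem_corner ξ η q.1) ?_).trans ?_
  · rw [hlin, hpq, op_smul_zero]
  · refine mul_le_mul_of_nonneg_left ((norm_smul_le' (compactOperators H) _ _).trans ?_) hC
    simp [hη]

theorem finiteOrthonormalDim_ker_of_leftInverse (ξ : Metric.sphere (0 : H) 1)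
    {Γ : Submodule ℂ (E × E)}
    (hs : IsStableGraph (compactOperators H) Γ)
    {G k : E →L[ℂ] E} (hk : k ∈ moduleCompacts (compactOperators H) E)
    (hG : ∀ q ∈ Γ, G q.2 = q.1 + k q.1) :
    FiniteOrthonormalDim (compactOperators H) (Γ.comap (LinearMap.inl ℂ E E)) := by
  refine finiteOrthonormalDim_of_compact_eigenvector ξ hs.isStable_ker
    (isCompactOperator_compression ξ hk) fun x hx => ?_
  have h := congrArg (slice ξ (ξ : H)) (hG _ hx)
  simp only [LinearMap.inl_apply, map_zero, map_add, slice_coe] at h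
  exact eq_neg_of_add_eq_zero_right h.symm

/-- For y ∈ eE orthogonal to X, y is orthogonal to v + kv for all v ∈ eE, so the adjoint of the
compressed k, again compact, sends y to -y. -/
theorem finiteOrthonormalDim_perp_of_rightInverse (ξ : Metric.sphere (0 : H) 1) {X : Submodule ℂ E}
    {k : E →L[ℂ] E} (hk : k ∈ moduleCompacts (compactOperators H) E)
    (hX : ∀ x, x + k x ∈ closure (X : Set E)) :
    FiniteOrthonormalDim (compactOperators H) (perp (compactOperators H) X) := by
  refine finiteOrthonormalDim_of_compact_eigenvector ξ (isStable_perp _ X)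
    ((compactOperators (corner E ξ)).star_mem' (isCompactOperator_compression ξ hk)) fun y hy => ?_
  have hcl : ∀ w ∈ closure (X : Set E), ⟪(y : E), w⟫_(compactOperators H) = 0 := by
    have : IsClosed {w | ⟪(y : E), w⟫_(compactOperators H) = 0} :=
      isClosed_eq (CStarModule.innerSL (A := compactOperators H) (y : E)).continuous
        continuous_const
    exact fun w hw => closure_minimal (fun x hx => hy x hx) this hw
  rw [eq_neg_iff_add_eq_zero]
  refine ext_inner_right ℂ fun v => ?_
  rw [inner_add_left, inner_zero_left, ContinuousLinearMap.star_eq_adjoint,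
    ContinuousLinearMap.adjoint_inner_left, ← inner_add_right]
  have h0 := inner_corner_eq_smul ξ y (compression ξ k v + v)
  have h1 : ((compression ξ k v + v : corner E ξ) : E) = ketBra (ξ : H) ξ • ((v : E) + k v) := by
    rw [op_smul_add, (mem_corner ξ).1 v.2, add_comm]
    rfl
  rw [h1, CStarModule.inner_op_smul_right, hcl _ (hX v), mul_zero] at h0
  exact (smul_eq_zero.1 h0.symm).resolve_right (isMinimalProjection_ketBra ξ).2.1

/-- A closed module relation with closed range, whose kernel and cokernel are the ranges of the
projections `p` and `q`, has an adjointable generalized inverse. -/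
theorem exists_generalizedInverse (ξ : Metric.sphere (0 : H) 1)
    {Γ : Submodule ℂ (E × E)} (hc : IsClosed (Γ : Set (E × E)))
    (hs : IsStableGraph (compactOperators H) Γ)
    (hran : IsClosed (Γ.map (LinearMap.snd ℂ E E) : Set E)) {p q : E →L[ℂ] E}
    (hp : ∀ x, (x, (0 : E)) ∈ Γ → p x = x) (hp' : ∀ x, (p x, (0 : E)) ∈ Γ)
    (hpa : ∀ (a : compactOperators H) (x : E), p (a • x) = a • p x)
    (hq : ∀ y ∈ perp (compactOperators H) (Γ.map (LinearMap.snd ℂ E E)), q y = y)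
    (hq' : ∀ y, q y ∈ perp (compactOperators H) (Γ.map (LinearMap.snd ℂ E E)))
    (hqs : ∀ z w, ⟪q z, w⟫_(compactOperators H) = ⟪z, q w⟫_(compactOperators H)) :
    ∃ G : E →L[ℂ] E, IsAdjointable (compactOperators H) G ∧ (∀ y, (G y, y - q y) ∈ Γ) ∧
      ∀ w ∈ Γ, G w.2 = w.1 - p w.1 := by
  let Γ' : Submodule ℂ (E × E) := Γ ⊓ LinearMap.ker ((p : E →ₗ[ℂ] E) ∘ₗ LinearMap.fst ℂ E E)
  have hΓ' : IsClosed (Γ' : Set (E × E)) :=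
    hc.inter (isClosed_singleton.preimage (p.continuous.comp continuous_fst))
  have := hΓ'.completeSpace_coe
  let X := Γ.map (LinearMap.snd ℂ E E)
  have : CompleteSpace X := hran.completeSpace_coe
  -- Two preimages of z differ by a kernel element, which p fixes.
  have huniq : ∀ {x x' z : E}, (x, z) ∈ Γ → (x', z) ∈ Γ → p x = p x' → x = x' := by
    intro x x' z hx hx' hpx
    have h1 : (x - x', (0 : E)) ∈ Γ := by simpa using Γ.sub_mem hx hx'
    have h2 := hp _ h1
    rw [map_sub, hpx, sub_self] at h2
    exact sub_eq_zero.1 h2.symm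
  let f : Γ' →L[ℂ] X :=
    (ContinuousLinearMap.snd ℂ E E ∘L Γ'.subtypeL).codRestrict X fun w => ⟨w.1, w.2.1, rfl⟩
  have hinj : LinearMap.ker (f : Γ' →ₗ[ℂ] X) = ⊥ := by
    refine LinearMap.ker_eq_bot'.2 fun w hw => ?_
    have hw2 : w.1.2 = 0 := congrArg Subtype.val hw
    have hpw : p w.1.1 = 0 := w.2.2
    have hw1 : w.1.1 = 0 := huniq (z := 0) (by rw [← hw2]; exact w.2.1) Γ.zero_mem (by simp [hpw])
    exact Subtype.ext (Prod.ext hw1 hw2)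
  have hsurj : LinearMap.range (f : Γ' →ₗ[ℂ] X) = ⊤ := by
    refine LinearMap.range_eq_top.2 ?_
    rintro ⟨_, w, hw, rfl⟩
    refine ⟨⟨(w.1 - p w.1, w.2), ?_, ?_⟩, rfl⟩
    · exact sub_fst_mem hw (hp' w.1)
    · simp [hp _ (hp' w.1)]
  -- The open mapping theorem makes the inverse bounded; this is where closed range enters.
  let e := ContinuousLinearEquiv.ofBijective f hinj hsurj
  have hqX : ∀ y, y - q y ∈ X := fun y =>
    mem_of_inner_perp_eq_zero ξ hs.isStable_ran hran fun v hv => by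
      rw [CStarModule.inner_sub_right, ← hqs, hq v hv, sub_self]
  let G : E →L[ℂ] E := ContinuousLinearMap.fst ℂ E E ∘L Γ'.subtypeL ∘L
    (e.symm : X →L[ℂ] Γ') ∘L (ContinuousLinearMap.id ℂ E - q).codRestrict X hqX
  have hG : ∀ y, (G y, y - q y) ∈ Γ' := by
    intro y
    have h1 : e (e.symm ⟨y - q y, hqX y⟩) = ⟨y - q y, hqX y⟩ := e.apply_symm_apply _
    have h2 : (e.symm ⟨y - q y, hqX y⟩ : Γ').1.2 = y - q y := congrArg Subtype.val h1
    have h3 : (G y, y - q y) = (e.symm ⟨y - q y, hqX y⟩ : Γ').1 := Prod.ext rfl h2.symm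
    rw [h3]
    exact Subtype.mem _
  have hGp : ∀ y, p (G y) = 0 := fun y => (hG y).2
  have hqa : ∀ (a : compactOperators H) (x : E), q (a • x) = a • q x :=
    IsAdjointable.map_op_smul ⟨q, fun x y => (hqs y x).symm⟩
  -- Both G(ax) and aGx are preimages of a(x - qx) killed by p, so `huniq` makes G a module map.
  refine ⟨G, isAdjointable_of_map_op_smul ξ fun a x => ?_, fun y => (hG y).1, fun w hw => ?_⟩
  · refine huniq (hG (a • x)).1 ?_ (by rw [hpa, hGp, hGp, op_smul_zero])
    rw [hqa, ← op_smul_sub]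
    exact hs a _ (hG x).1
  · have hqw : q w.2 = 0 := by
      rw [← CStarModule.inner_self (A := compactOperators H)]
      have h1 := hq' (q w.2) w.2 ⟨w, hw, rfl⟩
      rwa [hqs] at h1
    refine huniq (z := w.2) ?_ (sub_fst_mem hw (hp' w.1)) ?_
    · have := (hG w.2).1
      rwa [hqw, sub_zero] at this
    · rw [hGp, map_sub, hp _ (hp' w.1), sub_self]

end Graph

/-! ### Graphs, closures and adjoints of partially defined operators. -/

section PartialMapGraphs

variable {E : Type*} [AddCommGroup E] [Module ℂ E]

theorem mem_graph_everywhere {T : E →ₗ[ℂ] E} {x z : E} :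
    (x, z) ∈ (everywhere T).graph ↔ T x = z := by
  rw [LinearPMap.mem_graph_iff]
  exact ⟨fun ⟨y, hy, hz⟩ => by rw [← show (y : E) = x from hy]; exact hz,
    fun h => ⟨⟨x, trivial⟩, rfl, h⟩⟩

theorem mem_graph_pcomp {s t : E →ₗ.[ℂ] E} {x z : E} :
    (x, z) ∈ (pcomp s t).graph ↔ ∃ y, (x, y) ∈ t.graph ∧ (y, z) ∈ s.graph := by
  constructor
  · intro h
    obtain ⟨⟨x', ⟨⟨y, hy, hyx⟩, hx⟩⟩, hx', hz⟩ := (LinearPMap.mem_graph_iff _).1 h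
    obtain rfl : x' = x := hx'
    exact ⟨t ⟨x', hx⟩, t.mem_graph ⟨x', hx⟩, (LinearPMap.mem_graph_iff _).2 ⟨_, rfl, hz⟩⟩
  · rintro ⟨y, hxy, hyz⟩
    obtain ⟨x', rfl, rfl⟩ := (LinearPMap.mem_graph_iff _).1 hxy
    obtain ⟨y', hy', rfl⟩ := (LinearPMap.mem_graph_iff _).1 hyz
    have hmem : t x' ∈ s.domain := by rw [← show (y' : E) = t x' from hy']; exact y'.2
    refine (LinearPMap.mem_graph_iff _).2 ⟨⟨x', ⟨x', hmem, rfl⟩, x'.2⟩, rfl, ?_⟩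
    exact congrArg s (Subtype.ext hy'.symm)

theorem kernel_eq_comap_graph (t : E →ₗ.[ℂ] E) :
    kernel t = t.graph.comap (LinearMap.inl ℂ E E) := by
  ext x
  simp [kernel]

theorem ran_eq_map_graph (t : E →ₗ.[ℂ] E) : ran t = t.graph.map (LinearMap.snd ℂ E E) :=
  t.graph_map_snd_eq_range.symm

end PartialMapGraphs

theorem isClosed_everywhere {E : Type*} [NormedAddCommGroup E] [NormedSpace ℂ E]
    (T : E →L[ℂ] E) : (everywhere (T : E →ₗ[ℂ] E)).IsClosed := by
  have : ((everywhere (T : E →ₗ[ℂ] E)).graph : Set (E × E)) = {p | T p.1 = p.2} :=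
    Set.ext fun ⟨x, z⟩ => mem_graph_everywhere
  rw [LinearPMap.IsClosed, this]
  exact isClosed_eq (T.continuous.comp continuous_fst) continuous_snd

/-- A densely defined restriction of a bounded operator is closable, and its closure is that
operator. -/
theorem isClosable_and_closure_eq_everywhere {E : Type*} [NormedAddCommGroup E] [NormedSpace ℂ E]
    {s : E →ₗ.[ℂ] E} {T : E →L[ℂ] E} (hd : Dense (s.domain : Set E))
    (h : ∀ x : s.domain, s x = T x) :
    s.IsClosable ∧ s.closure = everywhere (T : E →ₗ[ℂ] E) := by
  have hle : s ≤ everywhere (T : E →ₗ[ℂ] E) := by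
    refine LinearPMap.le_of_le_graph ?_
    rintro ⟨x, z⟩ hxz
    obtain ⟨x', rfl, rfl⟩ := (LinearPMap.mem_graph_iff _).1 hxz
    exact mem_graph_everywhere.2 (h x').symm
  have hcl : s.IsClosable := (isClosed_everywhere T).isClosable.leIsClosable hle
  refine ⟨hcl, LinearPMap.eq_of_eq_graph ?_⟩
  rw [← hcl.graph_closure_eq_closure_graph]
  refine le_antisymm
    (Submodule.topologicalClosure_minimal _ (LinearPMap.le_graph_of_le hle)
      (isClosed_everywhere T)) ?_
  rintro ⟨x, z⟩ hxz
  obtain rfl : T x = z := mem_graph_everywhere.1 hxz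
  have hcont : Continuous fun x => (x, T x) := continuous_id.prodMk T.continuous
  refine map_mem_closure (f := fun x => (x, T x)) hcont (hd x) fun y hy => ?_
  have := s.mem_graph ⟨y, hy⟩
  rwa [h] at this

section Adjoint

variable {A : Type*} {E : Type*} [NonUnitalCStarAlgebra A] [PartialOrder A] [StarOrderedRing A]
  [NormedAddCommGroup E] [NormedSpace ℂ E] [SMul A E] [CStarModule A E]

theorem kernel_adjoint {t : E →ₗ.[ℂ] E} (ht : Dense (t.domain : Set E)) :
    kernel (adjoint A t) = perp A (ran t) := by
  rw [kernel_eq_comap_graph, graph_adjoint A t ht]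
  ext y
  constructor
  · rintro hy _ ⟨x, rfl⟩
    exact (hy x).trans (by simp)
  · intro hy x
    exact (hy _ ⟨x, rfl⟩).trans (by simp)

/-- A densely defined restriction of `1 - p`, with `p` a self-adjoint element of `K(E)`, has a
closure in `B(E)` that is `1` modulo `K(E)`. -/
theorem closureIsOneModCompacts_of_eq_sub {s : E →ₗ.[ℂ] E} {p : E →L[ℂ] E}
    (hd : Dense (s.domain : Set E)) (hp : p ∈ moduleCompacts A E)
    (hps : ∀ z w, ⟪p z, w⟫_A = ⟪z, p w⟫_A) (h : ∀ x : s.domain, s x = x - p x) :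
    ClosureIsOneModCompacts A s := by
  obtain ⟨h1, h2⟩ := isClosable_and_closure_eq_everywhere (T := 1 - p) hd h
  refine ⟨h1, 1 - p, ⟨fun y => y - p y, fun x y => ?_⟩, h2, ?_⟩
  · simp [hps]
  · rw [sub_sub_cancel_left]
    exact neg_mem hp

end Adjoint

/-! ### The equivalence. -/

section Main

variable {H : Type*} [NormedAddCommGroup H] [InnerProductSpace ℂ H] [CompleteSpace H]
  {E : Type*} [NormedAddCommGroup E] [NormedSpace ℂ E] [CompleteSpace E]
  [SMul (compactOperators H) E] [CStarModule (compactOperators H) E]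

theorem isFredholm_iff_of_sphere (ξ : Metric.sphere (0 : H) 1) {t : E →ₗ.[ℂ] E}
    (hlin : IsModuleLinear (compactOperators H) t) (hc : t.IsClosed)
    (hd : Dense (t.domain : Set E)) :
    IsFredholm (compactOperators H) t ↔
      IsClosed (ran t : Set E) ∧
        FiniteOrthonormalDim (compactOperators H) (kernel t) ∧
        FiniteOrthonormalDim (compactOperators H) (kernel (adjoint (compactOperators H) t)) := by
  have hs := hlin.isStableGraph
  rw [kernel_adjoint hd, kernel_eq_comap_graph, ran_eq_map_graph]
  constructor
  · rintro ⟨⟨G, -, -, T, -, hT, hTK⟩, ⟨G', -, hcl', T', -, hT', hTK'⟩⟩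
    have hG : ∀ w ∈ t.graph, G w.2 = w.1 + (T - 1) w.1 := by
      rintro ⟨x, z⟩ hw
      have h1 : (x, G z) ∈ (pcomp (everywhere (G : E →ₗ[ℂ] E)) t).graph :=
        mem_graph_pcomp.2 ⟨z, hw, mem_graph_everywhere.2 rfl⟩
      have h2 := LinearPMap.le_graph_of_le (LinearPMap.le_closure _) h1
      rw [hT] at h2
      have h3 : T x = G z := mem_graph_everywhere.1 h2
      simp [h3]
    have hX : ∀ x, x + (T' - 1) x ∈ closure (t.graph.map (LinearMap.snd ℂ E E) : Set E) := by
      intro x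
      have h1 : (x, T' x) ∈ (pcomp t (everywhere (G' : E →ₗ[ℂ] E))).closure.graph := by
        rw [hT']
        exact mem_graph_everywhere.2 rfl
      rw [← hcl'.graph_closure_eq_closure_graph] at h1
      -- T' is only the closure of tG', so its values are limits of elements of Ran t.
      have h2 : T' x ∈ closure (t.graph.map (LinearMap.snd ℂ E E) : Set E) := by
        refine map_mem_closure (f := Prod.snd) continuous_snd h1 ?_
        rintro ⟨y, z⟩ hyz
        obtain ⟨w, -, hw⟩ := mem_graph_pcomp.1 hyz
        exact ⟨_, hw, rfl⟩
      simpa using h2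
    have hker := finiteOrthonormalDim_ker_of_leftInverse ξ hs hTK hG
    obtain ⟨p, -, hpX, hp, hps⟩ := exists_projection_of_finiteOrthonormalDim (compactOperators H)
      hs.isStable_ker hker
    exact ⟨isClosed_ran_of_leftInverse ξ hc hs hTK hG hp hpX
      (IsAdjointable.map_op_smul ⟨p, fun x y => (hps y x).symm⟩), hker,
      finiteOrthonormalDim_perp_of_rightInverse ξ hTK' hX⟩
  · rintro ⟨hran, hker, hcoker⟩
    obtain ⟨p, hpK, hpX, hp, hps⟩ := exists_projection_of_finiteOrthonormalDim (compactOperators H)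
      hs.isStable_ker hker
    obtain ⟨q, hqK, hqX, hq, hqs⟩ := exists_projection_of_finiteOrthonormalDim (compactOperators H)
      (isStable_perp _ _) hcoker
    obtain ⟨G, hGa, hG, hG'⟩ := exists_generalizedInverse ξ hc hs hran hp hpX
      (IsAdjointable.map_op_smul ⟨p, fun x y => (hps y x).symm⟩) hq hqX hqs
    -- The same G serves on both sides: Gt is 1 - p on Dom t, and tG is 1 - q on all of E.
    refine ⟨⟨G, hGa, closureIsOneModCompacts_of_eq_sub ?_ hpK hps ?_⟩,
      ⟨G, hGa, closureIsOneModCompacts_of_eq_sub ?_ hqK hqs ?_⟩⟩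
    · refine hd.mono fun x hx => LinearPMap.mem_domain_iff.2 ⟨G (t ⟨x, hx⟩), ?_⟩
      exact mem_graph_pcomp.2 ⟨_, t.mem_graph ⟨x, hx⟩, mem_graph_everywhere.2 rfl⟩
    · intro x
      obtain ⟨y, hy, hyz⟩ := mem_graph_pcomp.1 (LinearPMap.mem_graph _ x)
      rw [← mem_graph_everywhere.1 hyz]
      exact hG' _ hy
    · convert dense_univ
      refine Set.eq_univ_of_forall fun x => LinearPMap.mem_domain_iff.2 ⟨x - q x, ?_⟩
      exact mem_graph_pcomp.2 ⟨G x, mem_graph_everywhere.2 rfl, hG x⟩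
    · intro x
      obtain ⟨y, hy, hyz⟩ := mem_graph_pcomp.1 (LinearPMap.mem_graph _ x)
      obtain rfl : G x = y := mem_graph_everywhere.1 hy
      exact LinearPMap.mem_graph_snd_inj t hyz (hG x) rfl

end Main

theorem finiteOrthonormalDim_of_subsingleton (A : Type*) {E : Type*} [NonUnitalCStarAlgebra A]
    [PartialOrder A] [NormedAddCommGroup E] [NormedSpace ℂ E] [SMul A E] [CStarModule A E]
    [Subsingleton E] (X : Submodule ℂ E) : FiniteOrthonormalDim A X := by
  refine ⟨0, ∅, ⟨by simp, ⟨by simp, by simp⟩, fun x _ => ?_⟩, by simp⟩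
  rw [Subsingleton.elim x 0]
  exact subset_closure (Submodule.zero_mem _)

theorem isFredholm_of_subsingleton (A : Type*) {E : Type*} [NonUnitalCStarAlgebra A]
    [PartialOrder A] [StarOrderedRing A] [NormedAddCommGroup E] [NormedSpace ℂ E] [SMul A E]
    [CStarModule A E] [Subsingleton E] (t : E →ₗ.[ℂ] E) : IsFredholm A t := by
  have h : ∀ s : E →ₗ.[ℂ] E, ClosureIsOneModCompacts A s := fun s =>
    closureIsOneModCompacts_of_eq_sub (p := 0)
      (fun x => by rw [Subsingleton.elim x 0]; exact subset_closure s.domain.zero_mem)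
      (zero_mem _) (fun z w => by simp) (fun x => Subsingleton.elim _ _)
  exact ⟨⟨0, ⟨0, fun x y => by simp⟩, h _⟩, ⟨0, ⟨0, fun x y => by simp⟩, h _⟩⟩

end HilbertModule

end

theorem theorem4p3 {H : Type*} [NormedAddCommGroup H] [InnerProductSpace ℂ H] [CompleteSpace H]
    {E : Type*} [NormedAddCommGroup E] [NormedSpace ℂ E] [CompleteSpace E]
    [SMul (compactOperators H) E] [CStarModule (compactOperators H) E]
    (t : E →ₗ.[ℂ] E) (ht : HilbertModule.IsRegular (compactOperators H) t) :
    HilbertModule.IsFredholm (compactOperators H) t ↔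
      IsClosed (HilbertModule.ran t : Set E) ∧
        HilbertModule.FiniteOrthonormalDim (compactOperators H) (HilbertModule.kernel t) ∧
        HilbertModule.FiniteOrthonormalDim (compactOperators H)
          (HilbertModule.kernel (HilbertModule.adjoint (compactOperators H) t)) := by
  -- If H = 0 there is no unit vector, but then E = 0 and both sides hold.
  rcases subsingleton_or_nontrivial H with hH | hH
  · have hE : Subsingleton E := subsingleton_of_forall_eq 0 fun x =>
      CStarModule.inner_self.1 (Subsingleton.elim (⟪x, x⟫_(compactOperators H)) 0)
    exact iff_of_true (HilbertModule.isFredholm_of_subsingleton _ t)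
      ⟨Set.subsingleton_of_subsingleton.isClosed,
        HilbertModule.finiteOrthonormalDim_of_subsingleton _ _,
        HilbertModule.finiteOrthonormalDim_of_subsingleton _ _⟩
  · obtain ⟨ξ, hξ⟩ := NormedSpace.sphere_nonempty (E := H) (x := 0) (r := 1) |>.2 zero_le_one
    exact HilbertModule.isFredholm_iff_of_sphere ⟨ξ, hξ⟩ ht.moduleLinear ht.closed ht.dense_domain
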